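/- Let $n\ge 1$ be an integer. Write points of $\mathbb{R}^n\times\mathbb{R}$ as $g=(x,u)$, $g'=(x',u')$, and let $|E|$ denote the Lebesgue measure of $E\subset\mathbb{R}^n\times\mathbb{R}$. Let $d_{CC}$ be the Carnot–Carathéodory distance associated with the Grushin vector fields $X_i=\partial/\partial x_i$, $U_i=x_i\,\partial/\partial u$ ($1\le i\le n$), that is, the infimum of $$\int_0^1\Big(\sum_{i=1}^n \big(a_i(t)^2+b_i(t)^2\big)\Big)^{1/2}dt$$ over all absolutely continuous curves $\gamma:[0,1]\to\mathbb{R}^n\times\mathbb{R}$ from $g$ to $g'$ and all measurable $a_i,b_i$ such that $\gamma'(t)=\sum_{i}\big(a_i(t)X_i(\gamma(t))+b_i(t)U_i(\gamma(t))\big)$ for almost every $t$. Let $$d_K(g,g')=\Big(\sqrt{(|x|^2+|x'|^2)^2+(2|u-u'|)^2}-2\,x\cdot x'\Big)^{1/2},$$ and let $B_{CC}(g,r)=\{g' : d_{CC}(g,g')<r\}$, $B_K(g,r)=\{g' : d_K(g,g')<r\}$. There is a constant $c>0$, independent of $n$, such that for every $n\ge 1$ and every $g\in\mathbb{R}^n\times\mathbb{R}$,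 $$|B_{CC}(g,1)|\ \ge\ c\,|B_K(g,1)|.$$ Moreover, with the same constant, the balls of $d_{CC}$ and $d_K$ have comparable volume uniformly in the dimension: for every $n\ge 1$, every $g\in\mathbb{R}^n\times\mathbb{R}$ and every $r>0$, $$c\,|B_K(g,r)|\ \le\ |B_{CC}(g,r)|\ \le\ |B_K(g,r)|.$$ -/

import Mathlib

open MeasureTheory
open scoped ENNReal

noncomputable section

/-- `γ : [0,1] → E` is a horizontal curve from `p` to `q` for the finite family of vector fields
`V`, with controls `a`: it is absolutely continuous on `[0,1]` and
`γ'(t) = ∑ i, a i t • V i (γ t)` for almost every `t ∈ [0,1]`. -/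
structure IsHorizontalCurve {ι E : Type*} [Fintype ι] [NormedAddCommGroup E] [NormedSpace ℝ E]
    (V : ι → E → E) (p q : E) (γ : ℝ → E) (a : ι → ℝ → ℝ) : Prop where
  absolutelyContinuous : AbsolutelyContinuousOnInterval γ 0 1
  measurable_control : ∀ i, AEMeasurable (a i) (volume.restrict (Set.Icc (0 : ℝ) 1))
  hasDerivAt : ∀ᵐ t ∂volume.restrict (Set.Icc (0 : ℝ) 1),
    HasDerivAt γ (∑ i, a i t • V i (γ t)) t
  source : γ 0 = p
  target : γ 1 = q

/-- The length `∫₀¹ (∑ i, a i (t) ^ 2) ^ (1/2) dt` of a horizontal curve with controls `a`. -/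
def controlLength {ι : Type*} [Fintype ι] (a : ι → ℝ → ℝ) : ℝ≥0∞ :=
  ∫⁻ t in Set.Icc (0 : ℝ) 1, ENNReal.ofReal (Real.sqrt (∑ i, a i t ^ 2))

/-- The Carnot-Carathéodory distance associated with the vector fields `V`: the infimum of the
lengths of the horizontal curves from `p` to `q` (`∞` if there is none). -/
def ccDist {ι E : Type*} [Fintype ι] [NormedAddCommGroup E] [NormedSpace ℝ E]
    (V : ι → E → E) (p q : E) : ℝ≥0∞ :=
  ⨅ (γ : ℝ → E) (a : ι → ℝ → ℝ) (_ : IsHorizontalCurve V p q γ a), controlLength a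

/-- The space `ℝⁿ × ℝ`, whose points are written `g = (x, u)`; its `volume` is Lebesgue measure. -/
abbrev GrushinSpace (n : ℕ) : Type := EuclideanSpace ℝ (Fin n) × ℝ

/-- The Grushin vector fields `X i = ∂/∂x i` (`Sum.inl i`) and `U i = x i ∂/∂u` (`Sum.inr i`). -/
def grushinField (n : ℕ) : Fin n ⊕ Fin n → GrushinSpace n → GrushinSpace n
  | Sum.inl i, _ => (EuclideanSpace.single i 1, 0)
  | Sum.inr i, g => (0, g.1 i)

/-- The Carnot-Carathéodory distance `d_CC` of the Grushin fields. -/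
def dCC {n : ℕ} (g g' : GrushinSpace n) : ℝ≥0∞ := ccDist (grushinField n) g g'

/-- The pseudo-distance
`d_K(g, g') = (√((|x|² + |x'|²)² + (2|u - u'|)²) - 2 x · x') ^ (1/2)`. -/
def dK {n : ℕ} (g g' : GrushinSpace n) : ℝ :=
  Real.sqrt (Real.sqrt ((‖g.1‖ ^ 2 + ‖g'.1‖ ^ 2) ^ 2 + (2 * |g.2 - g'.2|) ^ 2)
    - 2 * inner ℝ g.1 g'.1)

/-- The open ball `B_CC(g, r)`. -/
def ballCC {n : ℕ} (g : GrushinSpace n) (r : ℝ) : Set (GrushinSpace n) :=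
  {g' | dCC g g' < ENNReal.ofReal r}

/-- The open ball `B_K(g, r)`. -/
def ballK {n : ℕ} (g : GrushinSpace n) (r : ℝ) : Set (GrushinSpace n) :=
  {g' | dK g g' < r}

end

/-!
Write `g = (x, u)`, `g' = (x', u')`, `w = u' - u` and `y = x' - x`.

*Upper bound.* The inclusion `B_CC(g, r) ⊆ B_K(g, r)` holds because `d_K ≤ d_CC`: away from its
singularities, `d_K(g, ·)` has horizontal gradient of norm at most `1`. To avoid these singularities
`d_K` is replaced by the smooth function `dKReg δ`, in which `δ ^ 2` is added under the inner square
root. Its horizontal gradient is still at most `1` (`abs_fderiv_dKReg_le`), so its increment along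
a horizontal curve is at most the length of the curve
(`IsHorizontalCurve.ofReal_sub_le_controlLength`); then `δ` tends to `0` (`ofReal_dK_le_dCC`).

*Lower bound.* Since `(r² + 2 x · x')² - (|x|² + |x'|²)² = (r² - |y|²) (r² + |x + x'|²)`, a point of
`B_K(g, r)` satisfies `|y| < r` and `4 w² < (r² - |y|²) (r² + |x + x'|²)`. Conversely
`40 w² < (r² - |y|²) (r² + |x + x'|²)` forces `d_CC(g, g') < r` (`dCC_lt_of_mul_sq_lt`). For any
path `X` from `x` to `x'`, the controls `b = λ X` with `λ = w / ∫ |X|²` raise `u` to `u'`, and the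
resulting curve has energy `∫ |X'|² + w² / ∫ |X|²`. Take for `X` the segment from `x` to `x'` with
a parabolic bump added in a direction `e` with `(x + x') · e ≥ 0`, the bump using up half of the
energy `r² - |y|²` that the segment leaves available. Then `∫ |X|² ≥ (r² + |x + x'|²) / 20`.

Hence `B_CC(g, r)` contains the image of `B_K(g, r)` under the contraction by `1 / 4` of the `u` axis
towards `g`. This contraction acts on one coordinate only, so it multiplies the volume by `1 / 4`
whatever the dimension is.
-/

open Set

/-! ### Lipschitz functions along horizontal curves -/

theorem AbsolutelyContinuousOnInterval.contDiff_comp {E : Type*} [NormedAddCommGroup E]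
    [NormedSpace ℝ E] [ProperSpace E] {G : E → ℝ} (hG : ContDiff ℝ 1 G) {γ : ℝ → E} {a b : ℝ}
    (hγ : AbsolutelyContinuousOnInterval γ a b) :
    AbsolutelyContinuousOnInterval (G ∘ γ) a b := by
  obtain ⟨C, hC⟩ := hγ.exists_bound
  obtain ⟨K, hK⟩ := hG.contDiffOn.exists_lipschitzOnWith (s := Metric.closedBall (0 : E) C)
    (by decide) (convex_closedBall _ _) (isCompact_closedBall _ _)
  rw [absolutelyContinuousOnInterval_iff] at hγ ⊢
  intro ε hε
  obtain ⟨δ, hδ, h⟩ := hγ (ε / (K + 1)) (by positivity)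
  refine ⟨δ, hδ, fun I hI hI' ↦ ?_⟩
  calc ∑ i ∈ Finset.range I.1, dist (G (γ (I.2 i).1)) (G (γ (I.2 i).2))
      ≤ ∑ i ∈ Finset.range I.1, K * dist (γ (I.2 i).1) (γ (I.2 i).2) := by
        refine Finset.sum_le_sum fun i hi ↦ hK.dist_le_mul _ ?_ _ ?_
        · simpa using hC _ (hI.1 i hi).1
        · simpa using hC _ (hI.1 i hi).2
    _ = K * ∑ i ∈ Finset.range I.1, dist (γ (I.2 i).1) (γ (I.2 i).2) := by rw [Finset.mul_sum]
    _ ≤ K * (ε / (K + 1)) := by gcongr; exact (h I hI hI').le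
    _ < (K + 1) * (ε / (K + 1)) := by gcongr; linarith
    _ = ε := by field_simp

/-- A `C¹` function whose horizontal gradient is bounded by `1` increases along a horizontal curve
by at most the length of the curve. -/
theorem IsHorizontalCurve.ofReal_sub_le_controlLength {ι E : Type*} [Fintype ι]
    [NormedAddCommGroup E] [NormedSpace ℝ E] [ProperSpace E] {V : ι → E → E} {p q : E}
    {γ : ℝ → E} {a : ι → ℝ → ℝ} (h : IsHorizontalCurve V p q γ a) {G : E → ℝ}
    (hG : ContDiff ℝ 1 G)
    (hV : ∀ (z : E) (b : ι → ℝ),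
      |fderiv ℝ G z (∑ i, b i • V i z)| ≤ Real.sqrt (∑ i, b i ^ 2)) :
    ENNReal.ofReal (G q - G p) ≤ controlLength a := by
  have hI := (h.absolutelyContinuous.contDiff_comp hG).integral_deriv_eq_sub
  simp only [Function.comp_apply, h.source, h.target] at hI
  rw [← hI, intervalIntegral.integral_of_le zero_le_one, ← integral_Icc_eq_integral_Ioc]
  calc ENNReal.ofReal (∫ t in Icc (0 : ℝ) 1, deriv (G ∘ γ) t)
      ≤ ‖∫ t in Icc (0 : ℝ) 1, deriv (G ∘ γ) t‖ₑ := Real.ofReal_le_enorm _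
    _ ≤ ∫⁻ t in Icc (0 : ℝ) 1, ‖deriv (G ∘ γ) t‖ₑ := enorm_integral_le_lintegral_enorm _
    _ ≤ controlLength a := by
        refine lintegral_mono_ae ?_
        filter_upwards [h.hasDerivAt] with t ht
        have := ((hG.differentiable (by decide)) (γ t)).hasFDerivAt.comp_hasDerivAt t ht
        rw [this.deriv, Real.enorm_eq_ofReal_abs]
        exact ENNReal.ofReal_le_ofReal (hV _ _)

/-! ### The Grushin fields and the regularized pseudo-distance -/

theorem sum_smul_grushinField {n : ℕ} (b : Fin n ⊕ Fin n → ℝ) (z : GrushinSpace n) :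
    ∑ i, b i • grushinField n i z =
      (WithLp.toLp 2 (b ∘ Sum.inl),
        inner ℝ (WithLp.toLp 2 (b ∘ Sum.inr) : EuclideanSpace ℝ (Fin n)) z.1) := by
  rw [Fintype.sum_sum_type]
  refine Prod.ext ?_ ?_
  · ext j
    simp [grushinField, Prod.fst_sum, Pi.single_apply]
  · simp [grushinField, Prod.snd_sum, PiLp.inner_apply, mul_comm]

theorem sum_sq_eq_norm_sq_add_norm_sq {n : ℕ} (b : Fin n ⊕ Fin n → ℝ) :
    ∑ i, b i ^ 2 = ‖(WithLp.toLp 2 (b ∘ Sum.inl) : EuclideanSpace ℝ (Fin n))‖ ^ 2 +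
      ‖(WithLp.toLp 2 (b ∘ Sum.inr) : EuclideanSpace ℝ (Fin n))‖ ^ 2 := by
  simp [EuclideanSpace.norm_sq_eq]

/-- The function `d_K(g, g')` with `δ ^ 2` added under the inner square root; for `δ > 0` it is
smooth in `g'`. -/
noncomputable def dKReg {n : ℕ} (δ : ℝ) (g g' : GrushinSpace n) : ℝ :=
  Real.sqrt (Real.sqrt ((‖g.1‖ ^ 2 + ‖g'.1‖ ^ 2) ^ 2 + (2 * (g'.2 - g.2)) ^ 2 + δ ^ 2)
    - 2 * inner ℝ g.1 g'.1)

section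
variable {n : ℕ} {δ : ℝ}

theorem two_mul_inner_le_norm_sq_add_norm_sq {E : Type*} [NormedAddCommGroup E]
    [InnerProductSpace ℝ E] (x y : E) : 2 * inner ℝ x y ≤ ‖x‖ ^ 2 + ‖y‖ ^ 2 := by
  have := norm_sub_sq_real x y
  nlinarith [sq_nonneg ‖x - y‖]

theorem two_mul_inner_lt_sqrt (hδ : 0 < δ) (g g' : GrushinSpace n) :
    2 * inner ℝ g.1 g'.1 <
      Real.sqrt ((‖g.1‖ ^ 2 + ‖g'.1‖ ^ 2) ^ 2 + (2 * (g'.2 - g.2)) ^ 2 + δ ^ 2) := by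
  refine (two_mul_inner_le_norm_sq_add_norm_sq _ _).trans_lt (Real.lt_sqrt_of_sq_lt ?_)
  nlinarith [sq_nonneg (2 * (g'.2 - g.2)), pow_pos hδ 2]

theorem contDiff_dKReg (hδ : 0 < δ) (g : GrushinSpace n) : ContDiff ℝ 1 (dKReg δ g) := by
  unfold dKReg
  refine ContDiff.sqrt (ContDiff.sub (ContDiff.sqrt ?_ fun z ↦ ?_) ?_) fun z ↦ ?_
  · have h1 : ContDiff ℝ 1 fun z : GrushinSpace n ↦ ‖z.1‖ ^ 2 := contDiff_fst.norm_sq ℝ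
    have h2 : ContDiff ℝ 1 fun z : GrushinSpace n ↦ z.2 := contDiff_snd
    fun_prop
  · positivity
  · exact contDiff_const.mul (contDiff_const.inner ℝ contDiff_fst)
  · exact (sub_pos.2 (two_mul_inner_lt_sqrt hδ g z)).ne'

/-- The horizontal gradient of `dKReg δ g` has norm at most `1`. With `Q = (dKReg δ g)²`,
`A = |x|² + |x'|²` and `ρ` the inner square root, this is the estimate
`|(A / ρ) x' - x|² + (2 w / ρ)² |x'|² ≤ (A / ρ) Q ≤ Q`. -/
theorem abs_fderiv_dKReg_le (hδ : 0 < δ) (g z : GrushinSpace n) (b : Fin n ⊕ Fin n → ℝ) :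
    |fderiv ℝ (dKReg δ g) z (∑ i, b i • grushinField n i z)| ≤ Real.sqrt (∑ i, b i ^ 2) := by
  rw [sum_smul_grushinField, sum_sq_eq_norm_sq_add_norm_sq]
  set v : EuclideanSpace ℝ (Fin n) := WithLp.toLp 2 (b ∘ Sum.inl)
  set v' : EuclideanSpace ℝ (Fin n) := WithLp.toLp 2 (b ∘ Sum.inr)
  set β : ℝ := inner ℝ v' z.1 with hβ
  set A := ‖g.1‖ ^ 2 + ‖z.1‖ ^ 2 with hA
  set w := z.2 - g.2 with hw
  set ρ := Real.sqrt (A ^ 2 + (2 * w) ^ 2 + δ ^ 2) with hρ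
  have hρ0 : 0 < ρ := Real.sqrt_pos.2 (by positivity)
  have hρ2 : ρ ^ 2 = A ^ 2 + (2 * w) ^ 2 + δ ^ 2 := Real.sq_sqrt (by positivity)
  have hQ : 0 < ρ - 2 * inner ℝ g.1 z.1 := sub_pos.2 (two_mul_inner_lt_sqrt hδ g z)
  set Q := ρ - 2 * inner ℝ g.1 z.1 with hQdef
  have hD : fderiv ℝ (dKReg δ g) z (v, β) =
      (inner ℝ ((A / ρ) • z.1 - g.1) v + 2 * w / ρ * β) / Real.sqrt Q := by
    -- Differentiate along the line `z + s • (v, β)` and compare with the chain rule.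
    have h1 : HasDerivAt (fun s : ℝ ↦ z + s • ((v, β) : GrushinSpace n)) (v, β) 0 := by
      simpa using ((hasDerivAt_id (0 : ℝ)).smul_const ((v, β) : GrushinSpace n)).const_add z
    have hz : z + (0 : ℝ) • ((v, β) : GrushinSpace n) = z := by simp
    have h2 : HasDerivAt (fun s : ℝ ↦ dKReg δ g (z + s • ((v, β) : GrushinSpace n)))
        (fderiv ℝ (dKReg δ g) z (v, β)) 0 := by
      have := ((contDiff_dKReg hδ g).differentiable (by decide) z).hasFDerivAt
      rw [← hz] at this
      have h := this.comp_hasDerivAt (0 : ℝ) h1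
      rwa [hz] at h
    have hx : HasDerivAt (fun s : ℝ ↦ z.1 + s • v) v 0 := by
      simpa using ((hasDerivAt_id (0 : ℝ)).smul_const v).const_add z.1
    have hu : HasDerivAt (fun s : ℝ ↦ z.2 + s * β) β 0 := by
      simpa using ((hasDerivAt_id (0 : ℝ)).mul_const β).const_add z.2
    have h3 := (((((hx.norm_sq.const_add (‖g.1‖ ^ 2)).pow 2).add
      (((hu.sub_const g.2).const_mul 2).pow 2)).add_const (δ ^ 2)).sqrt
        (by simp; positivity)).sub
        (((hasDerivAt_const (0 : ℝ) g.1).inner ℝ hx).const_mul 2)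
    have h4 := h3.sqrt (by simpa using hQ.ne')
    have h5 := h2.unique (h4.congr_of_eventuallyEq (Filter.Eventually.of_forall fun s ↦ by
      simp [dKReg]))
    rw [h5]
    simp only [zero_smul, add_zero, zero_mul, Pi.add_apply, Pi.sub_apply, Pi.pow_apply,
      inner_zero_left]
    rw [← hA, ← hw, ← hρ, ← hQdef, inner_sub_left, inner_smul_left]
    have := (Real.sqrt_pos.2 hQ).ne'
    simp
    field_simp
    ring
  rw [hD, abs_div, abs_of_pos (Real.sqrt_pos.2 hQ), div_le_iff₀ (Real.sqrt_pos.2 hQ),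
    ← Real.sqrt_mul (by positivity)]
  apply Real.abs_le_sqrt
  set P := (A / ρ) • z.1 - g.1 with hP
  set κ := 2 * w / ρ with hκ
  have hPn : ‖P‖ ^ 2 + κ ^ 2 * ‖z.1‖ ^ 2 ≤ Q := by
    rw [hP, norm_sub_sq_real, norm_smul, inner_smul_left, real_inner_comm, mul_pow,
      Real.norm_eq_abs, sq_abs]
    have e1 : (A / ρ) ^ 2 + κ ^ 2 ≤ 1 := by
      rw [hκ, div_pow, div_pow, ← add_div, div_le_one (by positivity), hρ2]
      nlinarith [sq_nonneg δ]
    have e2 : A / ρ ≤ 1 := by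
      rw [div_le_one hρ0]
      exact Real.le_sqrt_of_sq_le (by nlinarith [sq_nonneg (2 * w), sq_nonneg δ])
    have e3 : A - 2 * (A / ρ * inner ℝ g.1 z.1) = A / ρ * Q := by
      rw [hQdef]; field_simp
    have e4 : A / ρ * Q ≤ Q := mul_le_of_le_one_left hQ.le e2
    have e5 := mul_le_mul_of_nonneg_right e1 (sq_nonneg ‖z.1‖)
    simp only [conj_trivial]
    linarith
  have c1 : |inner ℝ P v| ≤ ‖P‖ * ‖v‖ := abs_real_inner_le_norm _ _
  have c2 : |κ * β| ≤ (|κ| * ‖z.1‖) * ‖v'‖ := by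
    rw [abs_mul, mul_assoc, mul_comm ‖z.1‖]
    exact mul_le_mul_of_nonneg_left (abs_real_inner_le_norm _ _) (abs_nonneg _)
  calc (inner ℝ P v + κ * β) ^ 2
      ≤ (‖P‖ * ‖v‖ + (|κ| * ‖z.1‖) * ‖v'‖) ^ 2 := by
        rw [← sq_abs]
        gcongr
        exact (abs_add_le _ _).trans (add_le_add c1 c2)
    _ ≤ (‖P‖ ^ 2 + (|κ| * ‖z.1‖) ^ 2) * (‖v‖ ^ 2 + ‖v'‖ ^ 2) := by
        nlinarith [sq_nonneg (‖P‖ * ‖v'‖ - (|κ| * ‖z.1‖) * ‖v‖)]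
    _ ≤ (‖v‖ ^ 2 + ‖v'‖ ^ 2) * Q := by
        rw [mul_pow, sq_abs, mul_comm]
        gcongr

theorem dK_le_dKReg (g g' : GrushinSpace n) : dK g g' ≤ dKReg δ g g' := by
  unfold dK dKReg
  refine Real.sqrt_le_sqrt (sub_le_sub_right (Real.sqrt_le_sqrt ?_) _)
  rw [mul_pow, sq_abs, mul_pow, ← neg_sub g'.2 g.2, neg_sq]
  linarith [sq_nonneg δ]

theorem dKReg_self_le (hδ : 0 < δ) (g : GrushinSpace n) : dKReg δ g g ≤ Real.sqrt δ := by
  unfold dKReg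
  refine Real.sqrt_le_sqrt ?_
  rw [sub_le_iff_le_add, real_inner_self_eq_norm_sq]
  refine Real.sqrt_le_iff.2 ⟨by positivity, ?_⟩
  nlinarith [mul_nonneg hδ.le (sq_nonneg ‖g.1‖)]

/-- The pseudo-distance `d_K` is bounded by the Carnot-Carathéodory distance. -/
theorem ofReal_dK_le_dCC (g g' : GrushinSpace n) : ENNReal.ofReal (dK g g') ≤ dCC g g' := by
  refine le_iInf fun γ ↦ le_iInf fun a ↦ le_iInf fun h ↦ ?_
  have key : ∀ δ : ℝ, 0 < δ →
      ENNReal.ofReal (dK g g' - Real.sqrt δ) ≤ controlLength a := fun δ hδ ↦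
    (ENNReal.ofReal_le_ofReal
      (sub_le_sub (dK_le_dKReg g g') (dKReg_self_le hδ g))).trans
      (h.ofReal_sub_le_controlLength (contDiff_dKReg hδ g) (abs_fderiv_dKReg_le hδ g))
  have hlim : Filter.Tendsto (fun δ : ℝ ↦ ENNReal.ofReal (dK g g' - Real.sqrt δ))
      (nhdsWithin 0 (Ioi 0)) (nhds (ENNReal.ofReal (dK g g'))) := by
    have : Continuous fun δ : ℝ ↦ ENNReal.ofReal (dK g g' - Real.sqrt δ) :=
      ENNReal.continuous_ofReal.comp (by fun_prop)
    simpa using this.continuousWithinAt (s := Ioi 0) (x := 0) |>.tendsto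
  exact le_of_tendsto hlim (Filter.eventually_of_mem self_mem_nhdsWithin key)

theorem ballCC_subset_ballK (g : GrushinSpace n) (r : ℝ) : ballCC g r ⊆ ballK g r := fun g' hg' ↦
  lt_of_not_ge fun h ↦ absurd ((ENNReal.ofReal_le_ofReal h).trans (ofReal_dK_le_dCC g g'))
    (not_le.2 hg')

end

section
variable {n : ℕ}

/-! ### Explicit horizontal curves -/

/-- The horizontal curve over a path `X` in `ℝⁿ` with vertical controls `λ X`, `λ = (u' - u) / M`,
joins `(X 0, u)` to `(X 1, u')` and has energy `E = ∫ |X'|² + (u' - u)² / M`. Its length is at most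
`√E ≤ E / (2 r) + r / 2`. -/
theorem dCC_le_of_path {X X' : ℝ → EuclideanSpace ℝ (Fin n)} (hX : ∀ t, HasDerivAt X (X' t) t)
    (hX' : Continuous X') {M : ℝ} (hM : M = ∫ t in (0 : ℝ)..1, ‖X t‖ ^ 2) (hM0 : 0 < M)
    {r : ℝ} (hr : 0 < r) (u u' : ℝ) :
    dCC (X 0, u) (X 1, u') ≤ ENNReal.ofReal
      (((∫ t in (0 : ℝ)..1, ‖X' t‖ ^ 2) + (u' - u) ^ 2 / M) / (2 * r) + r / 2) := by
  have hXc : Continuous X := continuous_iff_continuousAt.2 fun t ↦ (hX t).continuousAt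
  have hc : Continuous fun t ↦ ‖X t‖ ^ 2 := by fun_prop
  set l := (u' - u) / M with hl
  set γ : ℝ → GrushinSpace n := fun t ↦ (X t, u + l * ∫ s in (0 : ℝ)..t, ‖X s‖ ^ 2) with hγ
  have hd : ∀ t, HasDerivAt γ (X' t, l * ‖X t‖ ^ 2) t := fun t ↦
    (hX t).prodMk (((hc.integral_hasStrictDerivAt 0 t).hasDerivAt.const_mul l).const_add u)
  set a : Fin n ⊕ Fin n → ℝ → ℝ :=
    fun i t ↦ Sum.elim (fun j ↦ X' t j) (fun j ↦ l * X t j) i with ha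
  have hcurve : IsHorizontalCurve (grushinField n) (X 0, u) (X 1, u') γ a := by
    refine ⟨ContDiffOn.absolutelyContinuousOnInterval (ContDiff.contDiffOn ?_), ?_, ?_, ?_, ?_⟩
    · rw [contDiff_one_iff_deriv]
      refine ⟨fun t ↦ (hd t).differentiableAt, ?_⟩
      rw [show deriv γ = _ from funext fun t ↦ (hd t).deriv]
      fun_prop
    · rintro (j | j)
      · exact Continuous.aemeasurable (by simp only [ha, Sum.elim_inl]; fun_prop)
      · exact Continuous.aemeasurable (by simp only [ha, Sum.elim_inr]; fun_prop)
    · refine Filter.Eventually.of_forall fun t ↦ ?_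
      refine (hd t).congr_deriv ?_
      rw [sum_smul_grushinField (fun i ↦ a i t), ← real_inner_self_eq_norm_sq,
        ← real_inner_smul_left]
      rfl
    · simp [hγ]
    · simp only [hγ, ← hM, hl]
      rw [div_mul_cancel₀ _ hM0.ne', add_sub_cancel]
  have hle : dCC (X 0, u) (X 1, u') ≤ controlLength a := by
    unfold dCC ccDist
    exact iInf₂_le_of_le γ a (iInf_le _ hcurve)
  refine hle.trans ?_
  have hs : ∀ t, ∑ i, a i t ^ 2 = ‖X' t‖ ^ 2 + l ^ 2 * ‖X t‖ ^ 2 := fun t ↦ by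
    simp [Fintype.sum_sum_type, ha, EuclideanSpace.norm_sq_eq, mul_pow, Finset.mul_sum]
  have hi1 : IntervalIntegrable (fun t ↦ ‖X' t‖ ^ 2) volume 0 1 :=
    Continuous.intervalIntegrable (by fun_prop) _ _
  have hi2 : IntervalIntegrable (fun t ↦ l ^ 2 * ‖X t‖ ^ 2) volume 0 1 :=
    Continuous.intervalIntegrable (by fun_prop) _ _
  calc controlLength a
      ≤ ∫⁻ t in Icc (0 : ℝ) 1,
          ENNReal.ofReal ((‖X' t‖ ^ 2 + l ^ 2 * ‖X t‖ ^ 2) / (2 * r) + r / 2) := by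
        refine lintegral_mono fun t ↦ ENNReal.ofReal_le_ofReal ?_
        rw [hs]
        set S := ‖X' t‖ ^ 2 + l ^ 2 * ‖X t‖ ^ 2
        have hS : Real.sqrt S ^ 2 = S := Real.sq_sqrt (by positivity)
        rw [← sub_nonneg, show S / (2 * r) + r / 2 - Real.sqrt S = (Real.sqrt S - r) ^ 2 / (2 * r)
          by rw [sub_sq, hS]; field_simp; ring]
        positivity
    _ = ENNReal.ofReal (∫ t in (0 : ℝ)..1,
          ((‖X' t‖ ^ 2 + l ^ 2 * ‖X t‖ ^ 2) / (2 * r) + r / 2)) := by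
        rw [intervalIntegral.integral_of_le zero_le_one, ← integral_Icc_eq_integral_Ioc,
          ofReal_integral_eq_lintegral_ofReal]
        · exact (Continuous.continuousOn (by fun_prop)).integrableOn_compact isCompact_Icc
        · exact Filter.Eventually.of_forall fun t ↦ by positivity
    _ = _ := by
        rw [intervalIntegral.integral_add ((hi1.add hi2).div_const _) (by simp),
          intervalIntegral.integral_div, intervalIntegral.integral_add hi1 hi2,
          intervalIntegral.integral_const_mul, ← hM, hl]
        congr 3
        · field_simp
        · simp

theorem integral_quartic (c₀ c₁ c₂ c₃ c₄ : ℝ) :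
    ∫ t in (0 : ℝ)..1, (c₀ + c₁ * t + c₂ * t ^ 2 + c₃ * t ^ 3 + c₄ * t ^ 4) =
      c₀ + c₁ / 2 + c₂ / 3 + c₃ / 4 + c₄ / 5 := by
  rw [intervalIntegral.integral_eq_sub_of_hasDerivAt
    (f := fun t ↦ c₀ * t + c₁ / 2 * t ^ 2 + c₂ / 3 * t ^ 3 + c₃ / 4 * t ^ 4 + c₄ / 5 * t ^ 5)]
  · ring
  · intro t _
    have h := (((((hasDerivAt_id t).const_mul c₀).add ((hasDerivAt_pow 2 t).const_mul (c₁ / 2))).add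
      ((hasDerivAt_pow 3 t).const_mul (c₂ / 3))).add ((hasDerivAt_pow 4 t).const_mul (c₃ / 4))).add
      ((hasDerivAt_pow 5 t).const_mul (c₄ / 5))
    refine HasDerivAt.congr_deriv h ?_
    norm_num
    ring
  · exact Continuous.intervalIntegrable (by fun_prop) _ _

theorem exists_norm_eq_one_inner_nonneg (hn : 1 ≤ n) (m : EuclideanSpace ℝ (Fin n)) :
    ∃ e : EuclideanSpace ℝ (Fin n), ‖e‖ = 1 ∧ 0 ≤ inner ℝ m e := by
  let e : EuclideanSpace ℝ (Fin n) := EuclideanSpace.single ⟨0, hn⟩ 1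
  rcases le_total 0 (inner ℝ m e) with h | h
  · exact ⟨e, by simp [e], h⟩
  · exact ⟨-e, by simp [e], by rw [inner_neg_right]; linarith⟩

/-- A sufficient condition for `d_CC < r`, which has the same form as the description of the balls
of `d_K`. The condition `1 ≤ n` is needed for a unit vector to exist. -/
theorem dCC_lt_of_mul_sq_lt (hn : 1 ≤ n) {x x' : EuclideanSpace ℝ (Fin n)} {u u' r : ℝ} (hr : 0 < r)
    (hxr : ‖x' - x‖ < r)
    (hu : 40 * (u' - u) ^ 2 < (r ^ 2 - ‖x' - x‖ ^ 2) * (r ^ 2 + ‖x + x'‖ ^ 2)) :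
    dCC (x, u) (x', u') < ENNReal.ofReal r := by
  set y := x' - x with hy
  set m := (1 / 2 : ℝ) • (x + x') with hm
  obtain ⟨e, he, hme⟩ := exists_norm_eq_one_inner_nonneg hn m
  have hgap : 0 < r ^ 2 - ‖y‖ ^ 2 :=
    sub_pos.2 (pow_lt_pow_left₀ hxr (norm_nonneg y) two_ne_zero)
  -- The bump `α t (1 - t) e` has energy `α² / 3`, which is half of `r² - |y|²`.
  set α := Real.sqrt (3 / 2 * (r ^ 2 - ‖y‖ ^ 2)) with hα
  have hα2 : α ^ 2 = 3 / 2 * (r ^ 2 - ‖y‖ ^ 2) := Real.sq_sqrt (by positivity)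
  set X : ℝ → EuclideanSpace ℝ (Fin n) := fun t ↦ m + (t - 1 / 2) • y + (α * (t * (1 - t))) • e
    with hX
  set X' : ℝ → EuclideanSpace ℝ (Fin n) := fun t ↦ y + (α * (1 - 2 * t)) • e with hX'
  have hXd : ∀ t, HasDerivAt X (X' t) t := fun t ↦ by
    have h1 : HasDerivAt (fun t : ℝ ↦ t - 1 / 2) 1 t := (hasDerivAt_id t).sub_const _
    have h2 : HasDerivAt (fun t : ℝ ↦ α * (t * (1 - t))) (α * (1 - 2 * t)) t := by
      refine (((hasDerivAt_id t).mul ((hasDerivAt_id t).const_sub 1)).const_mul α).congr_deriv ?_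
      simp only [id]
      ring
    exact (((h1.smul_const y).const_add m).add (h2.smul_const e)).congr_deriv (by simp [hX'])
  have hX0 : X 0 = x := by simp only [hX, hm, hy]; module
  have hX1 : X 1 = x' := by simp only [hX, hm, hy]; module
  have hE : ∫ t in (0 : ℝ)..1, ‖X' t‖ ^ 2 = ‖y‖ ^ 2 + α ^ 2 / 3 := by
    rw [show (fun t ↦ ‖X' t‖ ^ 2) = fun t ↦ (‖y‖ ^ 2 + 2 * α * inner ℝ y e + α ^ 2)
        + (-4 * α * inner ℝ y e - 4 * α ^ 2) * t + 4 * α ^ 2 * t ^ 2 + 0 * t ^ 3 + 0 * t ^ 4 by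
      funext t
      rw [hX', norm_add_sq_real, norm_smul, he, inner_smul_right, mul_one, Real.norm_eq_abs, sq_abs]
      ring, integral_quartic]
    ring
  have hMeq : ∫ t in (0 : ℝ)..1, ‖X t‖ ^ 2 =
      ‖m‖ ^ 2 + ‖y‖ ^ 2 / 12 + α ^ 2 / 30 + α / 3 * inner ℝ m e := by
    rw [show (fun t ↦ ‖X t‖ ^ 2) = fun t ↦ (‖m‖ ^ 2 - inner ℝ m y + ‖y‖ ^ 2 / 4)
        + (2 * inner ℝ m y - ‖y‖ ^ 2 + 2 * α * inner ℝ m e - α * inner ℝ y e) * t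
        + (‖y‖ ^ 2 - 2 * α * inner ℝ m e + 3 * α * inner ℝ y e + α ^ 2) * t ^ 2
        + (-2 * α * inner ℝ y e - 2 * α ^ 2) * t ^ 3 + α ^ 2 * t ^ 4 by
      funext t
      rw [hX, norm_add_sq_real, norm_add_sq_real, norm_smul _ y, norm_smul _ e, he,
        inner_add_left]
      simp only [inner_smul_right, inner_smul_left, conj_trivial, mul_one, mul_pow,
        Real.norm_eq_abs, sq_abs]
      ring, integral_quartic]
    ring
  have hm2 : ‖m‖ ^ 2 = ‖x + x'‖ ^ 2 / 4 := by
    rw [hm, norm_smul, mul_pow]; norm_num; ring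
  set M := ∫ t in (0 : ℝ)..1, ‖X t‖ ^ 2 with hM
  have hMlow : (r ^ 2 + ‖x + x'‖ ^ 2) / 20 ≤ M := by
    have : 0 ≤ α / 3 * inner ℝ m e := by positivity
    rw [hMeq, hm2, hα2]
    nlinarith [sq_nonneg ‖y‖, sq_nonneg ‖x + x'‖]
  have hM0 : 0 < M := lt_of_lt_of_le (by positivity) hMlow
  have hpath := dCC_le_of_path hXd (by rw [hX']; fun_prop) hM hM0 hr u u'
  rw [hX0, hX1] at hpath
  refine hpath.trans_lt ((ENNReal.ofReal_lt_ofReal_iff hr).2 ?_)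
  have hw : (u' - u) ^ 2 / M < (r ^ 2 - ‖y‖ ^ 2) / 2 := by
    rw [div_lt_iff₀ hM0]
    nlinarith
  rw [hE, hα2, ← lt_sub_iff_add_lt, div_lt_iff₀ (by positivity)]
  nlinarith

/-! ### Comparison of the balls -/

/-- The points of a ball of `d_K` satisfy explicit bounds, by the factorization
`(r² + 2 x · x')² - (|x|² + |x'|²)² = (r² - |x' - x|²) (r² + |x + x'|²)`. -/
theorem norm_sub_lt_and_mul_sq_lt_of_dK_lt {g g' : GrushinSpace n} {r : ℝ} (hr : 0 < r)
    (h : dK g g' < r) :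
    ‖g'.1 - g.1‖ < r ∧ 4 * (g'.2 - g.2) ^ 2 <
      (r ^ 2 - ‖g'.1 - g.1‖ ^ 2) * (r ^ 2 + ‖g.1 + g'.1‖ ^ 2) := by
  rw [dK, Real.sqrt_lt' hr, sub_lt_iff_lt_add] at h
  have hA : ‖g.1‖ ^ 2 + ‖g'.1‖ ^ 2 ≤
      Real.sqrt ((‖g.1‖ ^ 2 + ‖g'.1‖ ^ 2) ^ 2 + (2 * |g.2 - g'.2|) ^ 2) :=
    Real.le_sqrt_of_sq_le (by nlinarith [sq_nonneg (2 * |g.2 - g'.2|)])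
  have hpos : 0 < r ^ 2 + 2 * inner ℝ g.1 g'.1 := (Real.sqrt_nonneg _).trans_lt h
  have hAr := hA.trans_lt h
  rw [Real.sqrt_lt' hpos, mul_pow, sq_abs] at h
  have e1 := norm_sub_sq_real g'.1 g.1
  have e2 := norm_add_sq_real g.1 g'.1
  rw [real_inner_comm] at e1
  refine ⟨lt_of_pow_lt_pow_left₀ 2 hr.le (by linarith), ?_⟩
  rw [e1, e2]
  nlinarith

theorem isOpen_ballK (g : GrushinSpace n) (r : ℝ) : IsOpen (ballK g r) := by
  refine isOpen_lt ?_ continuous_const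
  unfold dK
  fun_prop

/-- If `t` contains the image of `s` under the dilation of ratio `c` of the last coordinate about
`u`, then the volume of `t` is at least `c` times that of `s`. -/
theorem ofReal_mul_volume_le_of_vertical_dilation {α : Type*} [MeasureSpace α]
    [SFinite (volume : Measure α)] {s : Set (α × ℝ)}
    {t : Set (α × ℝ)} (hs : MeasurableSet s) (u : ℝ) {c : ℝ} (hc : 0 < c)
    (h : ∀ p ∈ s, (p.1, u + c * (p.2 - u)) ∈ t) :
    ENNReal.ofReal c * volume s ≤ volume t := by
  -- `t` need not be measurable, so Fubini is applied to the dilated set itself.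
  refine le_trans ?_ (measure_mono (show {p | (p.1, u + c⁻¹ * (p.2 - u)) ∈ s} ⊆ t from ?_))
  · have hm : MeasurableSet {p : α × ℝ | (p.1, u + c⁻¹ * (p.2 - u)) ∈ s} :=
      hs.preimage (by fun_prop)
    rw [Measure.volume_eq_prod, Measure.prod_apply hs, Measure.prod_apply hm,
      ← lintegral_const_mul _ (measurable_measure_prodMk_left hs)]
    refine lintegral_mono fun x ↦ ?_
    rw [show ENNReal.ofReal c * volume (Prod.mk x ⁻¹' s) =
      volume (AffineMap.homothety u c '' (Prod.mk x ⁻¹' s)) by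
        rw [Measure.addHaar_image_homothety]; simp [abs_of_pos hc]]
    refine measure_mono ?_
    rintro _ ⟨v, hv, rfl⟩
    simpa [AffineMap.homothety_apply, hc.ne'] using hv
  · intro p hp
    simpa [hc.ne'] using h _ hp

theorem volume_ballK_le_volume_ballCC (hn : 1 ≤ n) (g : GrushinSpace n) {r : ℝ} (hr : 0 < r) :
    ENNReal.ofReal (1 / 4) * volume (ballK g r) ≤ volume (ballCC g r) := by
  refine ofReal_mul_volume_le_of_vertical_dilation (isOpen_ballK g r).measurableSet g.2
    (by norm_num) fun p hp ↦ ?_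
  obtain ⟨h1, h2⟩ := norm_sub_lt_and_mul_sq_lt_of_dK_lt hr hp
  refine dCC_lt_of_mul_sq_lt hn hr h1 ?_
  nlinarith [sq_nonneg (p.2 - g.2)]

end

theorem proposition5p2 :
    ∃ c : ℝ, 0 < c ∧ ∀ n : ℕ, 1 ≤ n → ∀ g : GrushinSpace n,
      ENNReal.ofReal c * volume (ballK g 1) ≤ volume (ballCC g 1) ∧
      ∀ r : ℝ, 0 < r →
        ENNReal.ofReal c * volume (ballK g r) ≤ volume (ballCC g r) ∧
        volume (ballCC g r) ≤ volume (ballK g r) :=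
  ⟨1 / 4, by norm_num, fun _ hn g ↦ ⟨volume_ballK_le_volume_ballCC hn g one_pos, fun r hr ↦
    ⟨volume_ballK_le_volume_ballCC hn g hr, measure_mono (ballCC_subset_ballK g r)⟩⟩⟩
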